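/- Let $H$ be a separable infinite-dimensional complex Hilbert space. Let $c_o^*$ be the set of real sequences decreasing (in the weak sense) to $0$. For a proper two-sided ideal $I$ of $B(H)$ (equivalently, a two-sided ideal of $B(H)$ contained in the compact operators), let $\Sigma(I)\subset c_o^*$ be its characteristic set, i.e. the set of all sequences $s(X)=\langle s_1(X),s_2(X),\dots\rangle$ of $s$-numbers of operators $X\in I$, and let $\operatorname{sc} I$ (the soft cover of $I$) be the two-sided ideal whose characteristic set is $$\{\xi\in c_o^* \mid \alpha\xi\in\Sigma(I)\text{ for all }\alpha\in c_o^*\},$$ i.e. the two-sided ideal generated by the diagonal operators $\operatorname{diag}\xi$ with $\xi$ in this set. The ideal $I$ is soft-complemented if $\operatorname{sc} I=I$. It is strongly soft-complemented if for every sequence $\eta^{(1)},\eta^{(2)},\dots$ of elements of $c_o^*\setminus\Sigma(I)$ there are indices $n_1,n_2,\dots\in\mathbb N$ such that $\xi\notin\Sigma(I)$ whenever $\xi\in c_o^*$ and $\xi_i\ge\eta^{(k)}_i$ for all $k$ and all $1\le i\le n_k$. An ideal is countably generated if it is generated, as a two-sided ideal, by a countable set of operators. **Theorem.** Let $I$ and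 $J$ be proper two-sided ideals of $B(H)$. If $I$ is strongly soft-complemented and $J$ is countably generated, then the sum $I+J$ is strongly soft-complemented, and hence soft-complemented. -/

import Mathlib

open Filter Topology

noncomputable section

/-- The set `c_o^*` of real sequences decreasing (i.e. nonincreasing) to `0`. Such sequences are
automatically nonnegative. Sequences are indexed from `0`: the term `ξ 0` is the first one. -/
def cZeroStar : Set (ℕ → ℝ) :=
  {ξ | Antitone ξ ∧ Tendsto ξ atTop (𝓝 0)}

variable {H : Type*} [NormedAddCommGroup H] [InnerProductSpace ℂ H]

/-- The sequence of `s`-numbers of a bounded Hilbert space operator: the term of index `n`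
(the `(n + 1)`-st `s`-number) is the distance of `X` to the operators of rank at most `n`.
For a compact operator this is the `(n + 1)`-st eigenvalue of `(X* X) ^ (1 / 2)`, in decreasing
order and repeated according to multiplicity. -/
def sNumbers (X : H →L[ℂ] H) (n : ℕ) : ℝ :=
  sInf {r : ℝ | ∃ F : H →L[ℂ] H, (F : H →ₗ[ℂ] H).rank ≤ (n : Cardinal) ∧ r = ‖X - F‖}

/-- The characteristic set `Σ(I)` of an ideal `I` of operators: the sequences in `c_o^*` that are
the sequence of `s`-numbers of some operator in `I`. -/
def charSet (I : TwoSidedIdeal (H →L[ℂ] H)) : Set (ℕ → ℝ) :=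
  {ξ | ξ ∈ cZeroStar ∧ ∃ X ∈ I, sNumbers X = ξ}

/-- `T` is the diagonal operator `diag ξ` with respect to some orthonormal basis of `H`. -/
def IsDiag (ξ : ℕ → ℝ) (T : H →L[ℂ] H) : Prop :=
  ∃ b : HilbertBasis ℕ ℂ H, ∀ n, T (b n) = (ξ n : ℂ) • b n

/-- The ideal with characteristic set `S`: the two-sided ideal generated by the diagonal operators
`diag ξ`, `ξ ∈ S`. (The operators `diag ξ` in different orthonormal bases are unitarily equivalent,
so that the choice of the basis does not matter.) -/
def idealOfCharSet (S : Set (ℕ → ℝ)) : TwoSidedIdeal (H →L[ℂ] H) :=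
  TwoSidedIdeal.span {T | ∃ ξ ∈ S, IsDiag ξ T}

/-- The soft cover `sc I`, i.e. the quotient of `I` by the ideal of compact operators: the ideal
with characteristic set `{ξ ∈ c_o^* | α ξ ∈ Σ(I) for all α ∈ c_o^*}`. -/
def softCover (I : TwoSidedIdeal (H →L[ℂ] H)) : TwoSidedIdeal (H →L[ℂ] H) :=
  idealOfCharSet {ξ | ξ ∈ cZeroStar ∧ ∀ α ∈ cZeroStar, α * ξ ∈ charSet I}

/-- `I` is soft-complemented if `sc I = I`. -/
def IsSoftComplemented (I : TwoSidedIdeal (H →L[ℂ] H)) : Prop :=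
  softCover I = I

/-- `I` is strongly soft-complemented if for every sequence `η⁽ᵏ⁾` of elements of `c_o^* \ Σ(I)`
there are indices `n_k` such that `ξ ∉ Σ(I)` whenever `ξ ∈ c_o^*` dominates, for all `k`, the
first `n_k` terms of `η⁽ᵏ⁾`. -/
def IsStronglySoftComplemented (I : TwoSidedIdeal (H →L[ℂ] H)) : Prop :=
  ∀ η : ℕ → ℕ → ℝ, (∀ k, η k ∈ cZeroStar \ charSet I) →
    ∃ n : ℕ → ℕ, ∀ ξ ∈ cZeroStar, (∀ k, ∀ i < n k, η k i ≤ ξ i) → ξ ∉ charSet I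

/-- `J` is countably generated as a two-sided ideal. -/
def IsCountablyGeneratedIdeal (J : TwoSidedIdeal (H →L[ℂ] H)) : Prop :=
  ∃ S : Set (H →L[ℂ] H), S.Countable ∧ J = TwoSidedIdeal.span S

end

/-! By Calkin's correspondence membership in a proper ideal depends only on s-numbers
(`exists_factorization_of_sNumbers_tendsto`, `sNumbers_tendsto_of_mem`), so the problem is one about
sequences. A countably generated `J` admits a sequence `ρ k` in Σ(J) such that the ampliated
s-numbers of each member of `J` lie below some `ρ k` (`exists_exhausting_sequence`). Hence ξ ∈ Σ(I +
J) exactly when ξ ≤ ζ + ρ k for some k and some ζ ∈ Σ(I) (`mem_charSet_sup_iff`). So if η ∉ Σ(I +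
J), then for every k the least nonincreasing majorant of the positive part of η - ρ k lies outside
Σ(I).

Given η⁽ᵐ⁾, the hypothesis on `I` is applied, for each fixed k, to these majorants with m ≥ k. Each
η⁽ᵐ⁾ then meets only the finitely many k ≤ m, so one index suffices for it. If ξ dominates the
resulting initial segments and ξ ≤ ζ + ρ k, then ζ dominates the initial segments required for that
k, whence ζ ∉ Σ(I).

Strong soft-complementedness implies soft-complementedness by testing it on the multiples ξ / (k +
1) of a sequence ξ outside the characteristic set. -/

/-! ### Approximation numbers: sums and products. -/

section SNumbers

variable {H : Type*} [NormedAddCommGroup H] [InnerProductSpace ℂ H]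

lemma sNumbers_bddBelow (X : H →L[ℂ] H) (n : ℕ) :
    BddBelow {r : ℝ | ∃ F : H →L[ℂ] H, (F : H →ₗ[ℂ] H).rank ≤ (n : Cardinal) ∧ r = ‖X - F‖} :=
  ⟨0, by rintro _ ⟨F, -, rfl⟩; exact norm_nonneg _⟩

lemma sNumbers_le {X F : H →L[ℂ] H} {n : ℕ} (hF : (F : H →ₗ[ℂ] H).rank ≤ (n : Cardinal)) :
    sNumbers X n ≤ ‖X - F‖ :=
  csInf_le (sNumbers_bddBelow X n) ⟨F, hF, rfl⟩

lemma le_sNumbers {X : H →L[ℂ] H} {n : ℕ} {c : ℝ}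
    (h : ∀ F : H →L[ℂ] H, (F : H →ₗ[ℂ] H).rank ≤ (n : Cardinal) → c ≤ ‖X - F‖) :
    c ≤ sNumbers X n := by
  refine le_csInf ⟨_, 0, ?_, rfl⟩ ?_
  · simp
  · rintro _ ⟨F, hF, rfl⟩
    exact h F hF

lemma exists_lt_of_sNumbers_lt {X : H →L[ℂ] H} {n : ℕ} {c : ℝ} (h : sNumbers X n < c) :
    ∃ F : H →L[ℂ] H, (F : H →ₗ[ℂ] H).rank ≤ (n : Cardinal) ∧ ‖X - F‖ < c := by
  by_contra! hc
  exact absurd (le_sNumbers hc) (not_le.2 h)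

lemma sNumbers_nonneg (X : H →L[ℂ] H) (n : ℕ) : 0 ≤ sNumbers X n :=
  le_sNumbers fun _ _ => norm_nonneg _

lemma sNumbers_antitone (X : H →L[ℂ] H) : Antitone (sNumbers X) := fun _ _ hmn =>
  le_sNumbers fun _ hF => sNumbers_le (hF.trans (by exact_mod_cast hmn))

lemma sNumbers_add_le (X Y : H →L[ℂ] H) (m n : ℕ) :
    sNumbers (X + Y) (m + n) ≤ sNumbers X m + sNumbers Y n := by
  refine le_of_forall_pos_le_add fun ε hε => ?_
  obtain ⟨F, hF, hXF⟩ := exists_lt_of_sNumbers_lt (lt_add_of_pos_right (sNumbers X m) (half_pos hε))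
  obtain ⟨G, hG, hYG⟩ := exists_lt_of_sNumbers_lt (lt_add_of_pos_right (sNumbers Y n) (half_pos hε))
  have hFG : ((F + G : H →L[ℂ] H) : H →ₗ[ℂ] H).rank ≤ ((m + n : ℕ) : Cardinal) := by
    push_cast
    exact (LinearMap.rank_add_le _ _).trans (add_le_add hF hG)
  have h := sNumbers_le (X := X + Y) hFG
  have h2 : ‖X + Y - (F + G)‖ ≤ ‖X - F‖ + ‖Y - G‖ := by
    rw [add_sub_add_comm]
    exact norm_add_le _ _
  linarith

lemma sNumbers_mul_mul_le (A X B : H →L[ℂ] H) (n : ℕ) :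
    sNumbers (A * X * B) n ≤ ‖A‖ * ‖B‖ * sNumbers X n := by
  refine le_of_forall_pos_le_add fun ε hε => ?_
  -- The summand 1 keeps the divisor of ε positive when `A` or `B` vanishes.
  have hC : 0 < ‖A‖ * ‖B‖ + 1 := by positivity
  obtain ⟨F, hF, hXF⟩ :=
    exists_lt_of_sNumbers_lt (lt_add_of_pos_right (sNumbers X n) (div_pos hε hC))
  have hr : ((A * F * B : H →L[ℂ] H) : H →ₗ[ℂ] H).rank ≤ (n : Cardinal) := by
    refine le_trans ?_ hF
    refine (LinearMap.rank_comp_le_left (B : H →ₗ[ℂ] H) ((A * F : H →L[ℂ] H) : H →ₗ[ℂ] H)).trans ?_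
    exact LinearMap.rank_comp_le_right (F : H →ₗ[ℂ] H) (A : H →ₗ[ℂ] H)
  have h := sNumbers_le (X := A * X * B) hr
  have e : A * X * B - A * F * B = A * (X - F) * B := by noncomm_ring
  have h2 : ‖A * (X - F) * B‖ ≤ ‖A‖ * ‖B‖ * ‖X - F‖ := by
    calc _ ≤ ‖A * (X - F)‖ * ‖B‖ := norm_mul_le _ _
      _ ≤ ‖A‖ * ‖X - F‖ * ‖B‖ := by gcongr; exact norm_mul_le _ _
      _ = _ := by ring
  have h3 : ‖A‖ * ‖B‖ * ‖X - F‖ ≤ ‖A‖ * ‖B‖ * (sNumbers X n + ε / (‖A‖ * ‖B‖ + 1)) := by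
    gcongr
  have h4 : ‖A‖ * ‖B‖ * (ε / (‖A‖ * ‖B‖ + 1)) ≤ ε := by
    rw [mul_div_assoc', div_le_iff₀ hC]
    nlinarith
  rw [e] at h
  linarith [mul_add (‖A‖ * ‖B‖) (sNumbers X n) (ε / (‖A‖ * ‖B‖ + 1))]

end SNumbers

/-! ### Operators defined on a Hilbert basis; diagonal operators. -/

section OrthogonalFamilies

variable {H : Type*} [NormedAddCommGroup H] [InnerProductSpace ℂ H]

lemma HilbertBasis.ext_clm (b : HilbertBasis ℕ ℂ H) {S T : H →L[ℂ] H}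
    (h : ∀ i, S (b i) = T (b i)) : S = T := by
  refine ContinuousLinearMap.ext_on (s := Set.range b) ?_ ?_
  · have := b.dense_span
    rw [Submodule.dense_iff_topologicalClosure_eq_top]
    exact this
  · rintro _ ⟨i, rfl⟩
    exact h i

lemma HilbertBasis.ext_inner (b : HilbertBasis ℕ ℂ H) {x y : H}
    (h : ∀ i, inner ℂ (b i) x = inner ℂ (b i) y) : x = y := by
  apply b.repr.injective
  ext i
  simp [b.repr_apply_apply, h]

lemma HilbertBasis.inner_eq_ite (b : HilbertBasis ℕ ℂ H) (i j : ℕ) :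
    inner ℂ (b i) (b j) = if i = j then (1 : ℂ) else 0 :=
  orthonormal_iff_ite.1 b.orthonormal i j

variable [CompleteSpace H]

/-- A bounded family of pairwise orthogonal vectors is the image of a Hilbert basis under a
bounded operator. -/
lemma HilbertBasis.exists_clm_of_orthogonal (b : HilbertBasis ℕ ℂ H) {w : ℕ → H} {C : ℝ}
    (hC : 0 ≤ C) (hw : ∀ i, ‖w i‖ ≤ C) (ho : ∀ i j, i ≠ j → inner ℂ (w i) (w j) = 0) :
    ∃ U : H →L[ℂ] H, ‖U‖ ≤ C ∧ ∀ i, U (b i) = w i := by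
  let G : ℕ → Submodule ℂ H := fun i => ℂ ∙ w i
  have hG : OrthogonalFamily ℂ (fun i => G i) fun i => (G i).subtypeₗᵢ := by
    intro i j hij x y
    obtain ⟨a, ha⟩ := Submodule.mem_span_singleton.1 x.2
    obtain ⟨c, hc⟩ := Submodule.mem_span_singleton.1 y.2
    simp only [Submodule.coe_subtypeₗᵢ, Submodule.coe_subtype, ← ha, ← hc, inner_smul_left,
      inner_smul_right, ho i j hij, mul_zero]
  let f : H → ∀ i, G i := fun x i => ⟨b.repr x i • w i, Submodule.smul_mem _ _
    (Submodule.mem_span_singleton_self _)⟩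
  have hfn : ∀ x i, ‖f x i‖ ^ 2 ≤ C ^ 2 * ‖b.repr x i‖ ^ 2 := by
    intro x i
    have : ‖f x i‖ = ‖b.repr x i‖ * ‖w i‖ := by
      simp [f, norm_smul]
    rw [this, mul_pow, mul_comm]
    gcongr
    exact hw i
  have hsum : ∀ x, Summable fun i => ‖b.repr x i‖ ^ 2 := by
    intro x
    have := (lp.memℓp (b.repr x)).summable (by norm_num)
    simpa using this
  have hfm : ∀ x, Memℓp (f x) 2 := by
    intro x
    refine memℓp_gen ?_
    have := Summable.of_nonneg_of_le (fun i => by positivity) (hfn x) ((hsum x).mul_left _)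
    simpa using this
  have hn : ∀ x, ‖(⟨f x, hfm x⟩ : lp (fun i => G i) 2)‖ ≤ C * ‖x‖ := by
    intro x
    refine le_of_sq_le_sq ?_ (by positivity) 
    have h1 := lp.norm_rpow_eq_tsum (p := 2) (by norm_num) (⟨f x, hfm x⟩ : lp (fun i => G i) 2)
    have h2 := lp.norm_rpow_eq_tsum (p := 2) (by norm_num) (b.repr x)
    simp only [ENNReal.toReal_ofNat, Real.rpow_ofNat, LinearIsometryEquiv.norm_map] at h1 h2
    rw [h1, mul_pow, h2, ← tsum_mul_left]
    refine Summable.tsum_le_tsum (hfn x) ?_ ((hsum x).mul_left _)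
    exact Summable.of_nonneg_of_le (fun i => by positivity) (hfn x) ((hsum x).mul_left _)
  let g : H →ₗ[ℂ] lp (fun i => G i) 2 :=
    { toFun := fun x => ⟨f x, hfm x⟩
      map_add' := fun x y => by
        ext i
        change b.repr (x + y) i • w i = b.repr x i • w i + b.repr y i • w i
        simp [add_smul]
      map_smul' := fun c x => by
        ext i
        simp [f, mul_smul] }
  refine ⟨hG.linearIsometry.toContinuousLinearMap.comp (g.mkContinuous C hn), ?_, ?_⟩
  · refine ContinuousLinearMap.opNorm_le_bound _ hC fun x => ?_
    have : ‖g x‖ ≤ C * ‖x‖ := hn x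
    simpa using this
  · intro i
    have : g (b i) = lp.single 2 i (⟨w i, Submodule.mem_span_singleton_self _⟩ : G i) := by
      ext j
      simp only [g, f, LinearMap.coe_mk, AddHom.coe_mk, b.repr_self, lp.single_apply]
      by_cases h : j = i
      · subst h; simp
      · simp [h]
    simp only [ContinuousLinearMap.comp_apply, LinearMap.mkContinuous_apply, this]
    simp

open Classical in
/-- The diagonal operator with the (bounded) diagonal `ξ` in the Hilbert basis `b`. -/
noncomputable def diagOp (b : HilbertBasis ℕ ℂ H) (ξ : ℕ → ℝ) : H →L[ℂ] H :=
  if h : ∃ U : H →L[ℂ] H, ∀ i, U (b i) = (ξ i : ℂ) • b i then h.choose else 0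

lemma HilbertBasis.exists_diag (b : HilbertBasis ℕ ℂ H) {ξ : ℕ → ℝ} {C : ℝ}
    (hξ : ∀ i, |ξ i| ≤ C) :
    ∃ U : H →L[ℂ] H, ‖U‖ ≤ C ∧ ∀ i, U (b i) = (ξ i : ℂ) • b i := by
  refine b.exists_clm_of_orthogonal ((abs_nonneg _).trans (hξ 0)) (fun i => ?_) fun i j hij => ?_
  · simpa [norm_smul, b.orthonormal.1 i] using hξ i
  · simp [b.inner_eq_ite, hij]

lemma diagOp_apply (b : HilbertBasis ℕ ℂ H) {ξ : ℕ → ℝ} {C : ℝ} (hξ : ∀ i, |ξ i| ≤ C) (i : ℕ) :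
    diagOp b ξ (b i) = (ξ i : ℂ) • b i := by
  have h : ∃ U : H →L[ℂ] H, ∀ i, U (b i) = (ξ i : ℂ) • b i :=
    let ⟨U, _, hU⟩ := b.exists_diag hξ; ⟨U, hU⟩
  rw [diagOp, dif_pos h]
  exact h.choose_spec i

lemma eq_diagOp (b : HilbertBasis ℕ ℂ H) {ξ : ℕ → ℝ} {C : ℝ} (hξ : ∀ i, |ξ i| ≤ C)
    {T : H →L[ℂ] H} (hT : ∀ i, T (b i) = (ξ i : ℂ) • b i) : T = diagOp b ξ :=
  b.ext_clm fun i => by rw [hT, diagOp_apply b hξ]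

lemma norm_diagOp_le (b : HilbertBasis ℕ ℂ H) {ξ : ℕ → ℝ} {C : ℝ} (hξ : ∀ i, |ξ i| ≤ C) :
    ‖diagOp b ξ‖ ≤ C := by
  obtain ⟨U, hU, h⟩ := b.exists_diag hξ
  rwa [← eq_diagOp b hξ h]

lemma diagOp_sub (b : HilbertBasis ℕ ℂ H) {ξ η : ℕ → ℝ} {C D : ℝ} (hξ : ∀ i, |ξ i| ≤ C)
    (hη : ∀ i, |η i| ≤ D) : diagOp b ξ - diagOp b η = diagOp b (ξ - η) := by
  refine eq_diagOp b (C := C + D) (fun i => ?_) fun i => ?_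
  · exact (abs_sub _ _).trans (add_le_add (hξ i) (hη i))
  · simp [diagOp_apply b hξ, diagOp_apply b hη, sub_smul]

lemma diagOp_add (b : HilbertBasis ℕ ℂ H) {ξ η : ℕ → ℝ} {C D : ℝ} (hξ : ∀ i, |ξ i| ≤ C)
    (hη : ∀ i, |η i| ≤ D) : diagOp b ξ + diagOp b η = diagOp b (ξ + η) := by
  refine eq_diagOp b (C := C + D) (fun i => ?_) fun i => ?_
  · exact (abs_add_le _ _).trans (add_le_add (hξ i) (hη i))
  · simp [diagOp_apply b hξ, diagOp_apply b hη, add_smul]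

lemma diagOp_mul (b : HilbertBasis ℕ ℂ H) {ξ η : ℕ → ℝ} {C D : ℝ} (hξ : ∀ i, |ξ i| ≤ C)
    (hη : ∀ i, |η i| ≤ D) : diagOp b ξ * diagOp b η = diagOp b (ξ * η) := by
  refine eq_diagOp b (C := C * D) (fun i => ?_) fun i => ?_
  · rw [Pi.mul_apply, abs_mul]
    exact mul_le_mul (hξ i) (hη i) (abs_nonneg _) ((abs_nonneg _).trans (hξ i))
  · rw [mul_apply_eq_comp, diagOp_apply b hη, map_smul, diagOp_apply b hξ, smul_smul,
      mul_comm, Pi.mul_apply, Complex.ofReal_mul]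

lemma Antitone.abs_le_zero {ξ : ℕ → ℝ} (h : Antitone ξ) (h0 : ∀ i, 0 ≤ ξ i) (i : ℕ) :
    |ξ i| ≤ ξ 0 := by
  rw [abs_of_nonneg (h0 i)]
  exact h (Nat.zero_le i)

lemma rank_diagOp_le (b : HilbertBasis ℕ ℂ H) {ξ : ℕ → ℝ} {C : ℝ} (hξ : ∀ i, |ξ i| ≤ C) {n : ℕ}
    (h0 : ∀ i, n ≤ i → ξ i = 0) : (diagOp b ξ : H →ₗ[ℂ] H).rank ≤ (n : Cardinal) := by
  let W : Submodule ℂ H := Submodule.span ℂ (Set.range fun i : Fin n => b i)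
  have hW : FiniteDimensional ℂ W := FiniteDimensional.span_of_finite ℂ (Set.finite_range _)
  have hr : ∀ x, diagOp b ξ x ∈ W := by
    intro x
    -- `W` is finite-dimensional, hence closed, so checking the basis vectors is enough.
    have hcl : IsClosed {x | diagOp b ξ x ∈ W} :=
      (Submodule.closed_of_finiteDimensional W).preimage (diagOp b ξ).continuous
    have hle : Submodule.span ℂ (Set.range b) ≤ W.comap (diagOp b ξ : H →ₗ[ℂ] H) := by
      rw [Submodule.span_le]
      rintro _ ⟨i, rfl⟩
      change diagOp b ξ (b i) ∈ W
      rw [diagOp_apply b hξ]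
      by_cases hi : i < n
      · exact W.smul_mem _ (Submodule.subset_span ⟨⟨i, hi⟩, rfl⟩)
      · simp [h0 i (not_lt.1 hi)]
    have hx : x ∈ (Submodule.span ℂ (Set.range b)).topologicalClosure := by
      rw [b.dense_span]; trivial
    exact closure_minimal (t := {x | diagOp b ξ x ∈ W}) hle hcl hx
  have h1 : LinearMap.range (diagOp b ξ : H →ₗ[ℂ] H) ≤ W := by
    rintro _ ⟨x, rfl⟩
    exact hr x
  refine (Submodule.rank_mono h1).trans ?_
  refine (rank_span_le _).trans ?_
  have h2 := Cardinal.mk_range_le_lift (f := fun i : Fin n => b (i : ℕ))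
  simpa using h2

/-- Truncating the diagonal after `n` terms gives the upper bound. For the lower one, an operator of
rank at most `n` kills a nonzero vector in the span of the first `n + 1` basis vectors, where the
diagonal operator expands norms by at least `ξ n`. -/
lemma sNumbers_diagOp (b : HilbertBasis ℕ ℂ H) {ξ : ℕ → ℝ} (h : Antitone ξ)
    (h0 : ∀ i, 0 ≤ ξ i) : sNumbers (diagOp b ξ) = ξ := by
  have hb := h.abs_le_zero h0
  funext n
  apply le_antisymm
  · let η : ℕ → ℝ := fun i => if i < n then ξ i else 0
    have hη : ∀ i, |η i| ≤ ξ 0 := by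
      intro i
      by_cases hi : i < n
      · simpa [η, hi] using hb i
      · simpa [η, hi] using h0 0
    refine (sNumbers_le (rank_diagOp_le b hη (n := n) fun i hi => ?_)).trans ?_
    · simp [η, not_lt.2 hi]
    · rw [diagOp_sub b hb hη]
      refine norm_diagOp_le b fun i => ?_
      by_cases hi : i < n
      · simpa [η, hi] using h0 n
      · simpa [η, hi, abs_of_nonneg (h0 i)] using h (not_lt.1 hi)
  · refine le_sNumbers fun F hF => ?_
    let φ : (Fin (n + 1) → ℂ) →ₗ[ℂ] H := Fintype.linearCombination ℂ fun i : Fin (n + 1) => b i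
    have hker : ∃ x, x ≠ 0 ∧ F (φ x) = 0 := by
      by_contra! hc
      have hfin : Module.Finite ℂ (LinearMap.range (F : H →ₗ[ℂ] H)) :=
        Module.rank_lt_aleph0_iff.1 (hF.trans_lt (Cardinal.natCast_lt_aleph0))
      have hinj : Function.Injective ((F : H →ₗ[ℂ] H).rangeRestrict ∘ₗ φ) := by
        rw [← LinearMap.ker_eq_bot, LinearMap.ker_eq_bot']
        intro x hx
        by_contra hx0
        exact hc x hx0 (congrArg Subtype.val hx)
      have h1 := LinearMap.finrank_le_finrank_of_injective hinj
      have h2 : Module.finrank ℂ (LinearMap.range (F : H →ₗ[ℂ] H)) ≤ n :=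
        Module.finrank_le_of_rank_le hF
      simp at h1
      omega
    obtain ⟨x, hx, hFx⟩ := hker
    have hortho : Orthonormal ℂ fun i : Fin (n + 1) => b i :=
      b.orthonormal.comp _ Fin.val_injective
    have hnorm : ∀ y : Fin (n + 1) → ℂ, ‖φ y‖ ^ 2 = ∑ i, ‖y i‖ ^ 2 := by
      intro y
      have h1 := hortho.inner_sum y y Finset.univ
      have h2 : φ y = ∑ i, y i • b (i : ℕ) := by simp [φ, Fintype.linearCombination_apply]
      rw [← h2, inner_self_eq_norm_sq_to_K] at h1
      have h3 : ∀ i, (starRingEnd ℂ) (y i) * y i = ((‖y i‖ ^ 2 : ℝ) : ℂ) := fun i => by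
        rw [RCLike.conj_mul]; simp
      simp only [h3] at h1
      apply Complex.ofReal_injective
      push_cast
      simpa using h1
    have hD : diagOp b ξ (φ x) = φ fun i => (ξ i : ℂ) * x i := by
      simp only [φ, Fintype.linearCombination_apply, map_sum, map_smul, diagOp_apply b hb,
        smul_smul, mul_comm]
    have hpos : 0 < ‖φ x‖ := by
      rw [norm_pos_iff]
      intro hc
      apply hx
      have := hnorm x
      rw [hc, norm_zero] at this
      have h3 := (Finset.sum_eq_zero_iff_of_nonneg fun i _ => by positivity).1
        (this.symm.trans (zero_pow two_ne_zero))
      funext i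
      simpa using h3 i (Finset.mem_univ i)
    have hle : ξ n * ‖φ x‖ ≤ ‖diagOp b ξ (φ x)‖ := by
      refine le_of_sq_le_sq ?_ (norm_nonneg _)
      rw [mul_pow, hD, hnorm, hnorm, Finset.mul_sum]
      refine Finset.sum_le_sum fun i _ => ?_
      rw [norm_mul, mul_pow]
      have : ξ n ≤ ‖(ξ i : ℂ)‖ := by
        rw [Complex.norm_real, Real.norm_of_nonneg (h0 _)]
        exact h (Nat.lt_succ_iff.1 i.2)
      gcongr
      exact h0 n
    have hop := (diagOp b ξ - F).le_opNorm (φ x)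
    rw [sub_apply, hFx, sub_zero] at hop
    exact le_of_mul_le_mul_right (hle.trans hop) hpos

end OrthogonalFamilies

/-! ### Singular value decomposition of compact operators. -/

section SingularValues

variable {H : Type*} [NormedAddCommGroup H] [InnerProductSpace ℂ H] [CompleteSpace H]

lemma isCompactOperator_of_sNumbers_tendsto {T : H →L[ℂ] H}
    (hT : Tendsto (sNumbers T) atTop (𝓝 0)) : IsCompactOperator T := by
  have h : ∀ n : ℕ, ∃ F : H →L[ℂ] H, IsCompactOperator F ∧
      ‖T - F‖ < sNumbers T n + 1 / ((n : ℝ) + 1) := by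
    intro n
    obtain ⟨F, hF, hTF⟩ := exists_lt_of_sNumbers_lt (lt_add_of_pos_right (sNumbers T n)
      (Nat.one_div_pos_of_nat (α := ℝ) (n := n)))
    refine ⟨F, ?_, hTF⟩
    have : FiniteDimensional ℂ (LinearMap.range (F : H →ₗ[ℂ] H)) :=
      Module.rank_lt_aleph0_iff.1 (hF.trans_lt Cardinal.natCast_lt_aleph0)
    have : ProperSpace (LinearMap.range (F : H →ₗ[ℂ] H)) := FiniteDimensional.proper_rclike ℂ _
    have hr : IsCompactOperator (F.rangeRestrict) :=
      isCompactOperator_of_locallyCompactSpace_dom _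
    exact hr.clm_comp (LinearMap.range (F : H →ₗ[ℂ] H)).subtypeL
  choose F hF hTF using h
  refine isCompactOperator_of_tendsto (F := F) (l := atTop) ?_ (Eventually.of_forall hF)
  rw [tendsto_iff_norm_sub_tendsto_zero]
  refine squeeze_zero (fun _ => norm_nonneg _) (fun n => ?_)
    (by simpa using hT.add (tendsto_one_div_add_atTop_nhds_zero_nat (𝕜 := ℝ)))
  rw [norm_sub_rev]
  simpa using (hTF n).le

open ContinuousLinearMap in
/-- A nonzero compact operator attains its norm, at an eigenvector of `T* T`. -/
lemma IsCompactOperator.exists_norm_eigenvector {T : H →L[ℂ] H} (hT : IsCompactOperator T)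
    (h0 : T ≠ 0) : ∃ v : H, ‖v‖ = 1 ∧ adjoint T (T v) = ((‖T‖ ^ 2 : ℝ) : ℂ) • v := by
  have : Nontrivial H := by
    by_contra hH
    rw [not_nontrivial_iff_subsingleton] at hH
    exact h0 (ContinuousLinearMap.ext fun x => Subsingleton.elim _ _)
  let A : H →L[ℂ] H := adjoint T * T
  have hA : IsSelfAdjoint A := IsSelfAdjoint.star_mul_self T
  have hAc : IsCompactOperator A := hT.clm_comp (adjoint T)
  have hAn : ‖A‖ = ‖T‖ ^ 2 := by
    rw [sq]; exact CStarRing.norm_star_mul_self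
  -- A self-adjoint operator has spectral radius equal to its norm, and a nonzero spectral value of
  -- a compact operator is an eigenvalue.
  obtain ⟨k, hk, hkn⟩ := spectrum.exists_nnnorm_eq_spectralRadius A
  rw [hA.spectralRadius_eq_nnnorm] at hkn
  have hkn' : ‖k‖ = ‖A‖ := by
    have := ENNReal.coe_injective hkn
    exact congrArg NNReal.toReal this
  have hTn : 0 < ‖T‖ := norm_pos_iff.2 h0
  have hk0 : k ≠ 0 := by
    rw [← norm_pos_iff, hkn', hAn]; positivity
  obtain ⟨w, hw⟩ := ((hAc.hasEigenvalue_iff_mem_spectrum hk0).2 hk).exists_hasEigenvector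
  have hAw : A w = k • w := hw.apply_eq_smul
  have hw0 : w ≠ 0 := hw.2
  have hkk : k = ((‖T‖ ^ 2 : ℝ) : ℂ) := by
    have h1 : inner ℂ w (A w) = inner ℂ (T w) (T w) := adjoint_inner_right T w (T w)
    rw [hAw, inner_smul_right, inner_self_eq_norm_sq_to_K, inner_self_eq_norm_sq_to_K] at h1
    have hwn : 0 < ‖w‖ := norm_pos_iff.2 hw0
    have h2 : k = ((‖T w‖ ^ 2 / ‖w‖ ^ 2 : ℝ) : ℂ) := by
      push_cast
      rw [eq_div_iff (by exact_mod_cast (pow_pos hwn 2).ne')]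
      exact h1
    rw [h2, Complex.norm_real, Real.norm_of_nonneg (by positivity), hAn] at hkn'
    rw [h2, hkn']
  refine ⟨((‖w‖⁻¹ : ℝ) : ℂ) • w, ?_, ?_⟩
  · rw [norm_smul, Complex.norm_real, norm_inv, norm_norm,
      inv_mul_cancel₀ (norm_ne_zero_iff.2 hw0)]
  · have : adjoint T (T w) = k • w := hAw
    rw [map_smul, map_smul, this, hkk, smul_comm]

omit [CompleteSpace H] in
lemma norm_sub_inner_smul_le {v : H} (hv : ‖v‖ ≤ 1) (x : H) : ‖x - inner ℂ v x • v‖ ≤ ‖x‖ := by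
  refine le_of_sq_le_sq ?_ (norm_nonneg _)
  have h1 : inner ℂ x (inner ℂ v x • v) = ((‖(inner ℂ v x : ℂ)‖ ^ 2 : ℝ) : ℂ) := by
    rw [inner_smul_right, ← inner_conj_symm x v, Complex.mul_conj, Complex.normSq_eq_norm_sq]
  have h2 : (‖(inner ℂ v x : ℂ)‖ * ‖v‖) ^ 2 ≤ ‖(inner ℂ v x : ℂ)‖ ^ 2 := by
    rw [mul_pow]
    exact mul_le_of_le_one_right (sq_nonneg _) (pow_le_one₀ (norm_nonneg _) hv)
  have h3 : 0 ≤ ‖(inner ℂ v x : ℂ)‖ ^ 2 := sq_nonneg _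
  rw [norm_sub_sq (𝕜 := ℂ), h1, norm_smul]
  have h4 : RCLike.re (((‖(inner ℂ v x : ℂ)‖ ^ 2 : ℝ) : ℂ)) = ‖(inner ℂ v x : ℂ)‖ ^ 2 :=
    Complex.ofReal_re _
  rw [h4]
  linarith

open ContinuousLinearMap in
/-- The top of the singular value decomposition of `T`, padded with zero if `T = 0`. -/
lemma IsCompactOperator.exists_top {T : H →L[ℂ] H} (hT : IsCompactOperator T) :
    ∃ v : H, adjoint T (T v) = ((‖T‖ ^ 2 : ℝ) : ℂ) • v ∧ (T ≠ 0 → ‖v‖ = 1) ∧ (T = 0 → v = 0) := by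
  by_cases h : T = 0
  · exact ⟨0, by simp, fun h' => absurd h h', fun _ => rfl⟩
  · obtain ⟨v, hv, hv'⟩ := hT.exists_norm_eigenvector h
    exact ⟨v, hv', fun _ => hv, fun h' => absurd h' h⟩

/-- `deflate T v = T - ⟪v, ·⟫ T v`. -/
noncomputable def deflate (T : H →L[ℂ] H) (v : H) : H →L[ℂ] H :=
  T - (innerSL ℂ v).smulRight (T v)

omit [CompleteSpace H] in
lemma deflate_apply (T : H →L[ℂ] H) (v x : H) : deflate T v x = T x - inner ℂ v x • T v := by
  simp [deflate]

omit [CompleteSpace H] in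
lemma isCompactOperator_deflate {T : H →L[ℂ] H} (hT : IsCompactOperator T) (v : H) :
    IsCompactOperator (deflate T v) := by
  have h : deflate T v = T ∘L (ContinuousLinearMap.id ℂ H - (innerSL ℂ v).smulRight v) := by
    ext x; simp [deflate]
  rw [h]
  exact hT.comp_clm _

open ContinuousLinearMap in
/-- The singular value decomposition of a compact operator. -/
lemma IsCompactOperator.exists_svd {T : H →L[ℂ] H} (hT : IsCompactOperator T) :
    ∃ (t : ℕ → ℝ) (v : ℕ → H), Antitone t ∧ (∀ i, 0 ≤ t i) ∧
      (∀ i j, i ≠ j → inner ℂ (v i) (v j) = 0) ∧ (∀ i, t i ≠ 0 → ‖v i‖ = 1) ∧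
      (∀ i, t i = 0 → v i = 0) ∧ (∀ i j, i ≠ j → inner ℂ (T (v i)) (T (v j)) = 0) ∧
      (∀ i, ‖T (v i)‖ = t i) ∧ ∀ y, (∀ i, inner ℂ (v i) y = 0) → ∀ n, ‖T y‖ ≤ t n * ‖y‖ := by
  have htop : ∀ S : {S : H →L[ℂ] H // IsCompactOperator S}, ∃ v : H,
      adjoint S.1 (S.1 v) = ((‖S.1‖ ^ 2 : ℝ) : ℂ) • v ∧ (S.1 ≠ 0 → ‖v‖ = 1) ∧ (S.1 = 0 → v = 0) :=
    fun S => S.2.exists_top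
  choose top htop1 htop2 htop3 using htop
  -- Repeated deflation: `R (n + 1)` is `R n` with its top singular vector `v n` removed.
  let R : ℕ → {S : H →L[ℂ] H // IsCompactOperator S} := fun n =>
    Nat.rec ⟨T, hT⟩ (fun _ S => ⟨deflate S.1 (top S), isCompactOperator_deflate S.2 _⟩) n
  let v : ℕ → H := fun n => top (R n)
  have hRs : ∀ n x, (R (n + 1)).1 x = (R n).1 x - inner ℂ (v n) x • (R n).1 (v n) :=
    fun n x => deflate_apply _ _ _
  have hv1 : ∀ i, ‖v i‖ ≤ 1 := fun i => by
    by_cases h : (R i).1 = 0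
    · simp [v, htop3 _ h]
    · exact (htop2 _ h).le
  have hkill : ∀ i, (R (i + 1)).1 (v i) = 0 := fun i => by
    rw [hRs]
    by_cases h : (R i).1 = 0
    · simp [h]
    · have : ‖v i‖ = 1 := htop2 _ h
      rw [inner_self_eq_norm_sq_to_K, this]
      simp
  have hanti : Antitone fun n => ‖(R n).1‖ := by
    refine antitone_nat_of_succ_le fun n => ?_
    refine opNorm_le_bound _ (norm_nonneg _) fun x => ?_
    rw [hRs, ← map_smul, ← map_sub]
    exact ((R n).1.le_opNorm _).trans
      (mul_le_mul_of_nonneg_left (norm_sub_inner_smul_le (hv1 n) x) (norm_nonneg _))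
  have hinner : ∀ m x, inner ℂ ((R m).1 (v m)) ((R m).1 x) = ((‖(R m).1‖ ^ 2 : ℝ) : ℂ) *
      inner ℂ (v m) x := fun m x => by
    rw [← adjoint_inner_left, htop1, inner_smul_left, Complex.conj_ofReal]
  -- The kernel of `R m` is orthogonal to `v m`, an eigenvector of `(R m)* R m` with eigenvalue `‖R
  -- m‖ ^ 2`. Since `v i` stays in the kernel of every later `R m`, all the `v i` are orthogonal.
  have horth' : ∀ m x, (R m).1 x = 0 → inner ℂ (v m) x = 0 := fun m x hx => by
    by_cases h : (R m).1 = 0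
    · simp [v, htop3 _ h]
    · have h1 := hinner m x
      rw [hx, inner_zero_right] at h1
      refine (mul_eq_zero.1 h1.symm).resolve_left ?_
      exact_mod_cast pow_ne_zero 2 (norm_ne_zero_iff.2 h)
  have hkill' : ∀ i k, (R (i + 1 + k)).1 (v i) = 0 := by
    intro i k
    induction k with
    | zero => exact hkill i
    | succ k ih =>
      rw [← add_assoc, hRs, ih, horth' _ _ ih]
      simp
  have horth : ∀ i j, i < j → inner ℂ (v j) (v i) = 0 := fun i j hij => by
    obtain ⟨k, rfl⟩ := Nat.exists_eq_add_of_le hij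
    exact horth' _ _ (hkill' i k)
  have horth2 : ∀ i j, i ≠ j → inner ℂ (v i) (v j) = 0 := fun i j hij => by
    rcases lt_or_gt_of_ne hij with h | h
    · rw [← inner_conj_symm, horth i j h, map_zero]
    · exact horth j i h
  have hsame : ∀ x m, (∀ i < m, inner ℂ (v i) x = 0) → (R m).1 x = T x := by
    intro x m
    induction m with
    | zero => intro _; rfl
    | succ m ih =>
      intro h
      rw [hRs, ih fun i hi => h i (hi.trans m.lt_succ_self), h m m.lt_succ_self]
      simp
  have hsame' : ∀ m n, m ≤ n → (R m).1 (v n) = T (v n) := fun m n hmn =>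
    hsame _ _ fun i hi => horth2 _ _ (hi.trans_le hmn).ne
  have hTorth : ∀ i j, i < j → inner ℂ (T (v i)) (T (v j)) = 0 := fun i j hij => by
    rw [← hsame' i i le_rfl, ← hsame' i j hij.le, hinner, horth2 i j hij.ne, mul_zero]
  refine ⟨fun n => ‖(R n).1‖, v, hanti, fun _ => norm_nonneg _, horth2, fun i hi => htop2 _ ?_,
    fun i hi => htop3 _ (norm_eq_zero.1 hi), fun i j hij => ?_, fun i => ?_, fun y hy n => ?_⟩
  · exact fun h => hi (norm_eq_zero.2 h)
  · rcases lt_or_gt_of_ne hij with h | h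
    · exact hTorth i j h
    · rw [← inner_conj_symm, hTorth j i h, map_zero]
  · rw [← hsame' i i le_rfl]
    by_cases h : (R i).1 = 0
    · simp [h]
    · have h1 := hinner i (v i)
      have h2 : ‖v i‖ = 1 := htop2 _ h
      rw [inner_self_eq_norm_sq_to_K, inner_self_eq_norm_sq_to_K, h2] at h1
      have h3 : ‖(R i).1 (v i)‖ ^ 2 = ‖(R i).1‖ ^ 2 := by
        apply Complex.ofReal_injective
        push_cast at h1 ⊢
        simpa using h1
      exact (sq_eq_sq₀ (norm_nonneg _) (norm_nonneg _)).1 h3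
  · rw [← hsame y n fun i _ => hy i]
    exact (R n).1.le_opNorm y

open ContinuousLinearMap in
/-- A compact operator and the diagonal operator of its `s`-numbers factor through each other. -/
lemma exists_factorization_of_sNumbers_tendsto (b : HilbertBasis ℕ ℂ H) {T : H →L[ℂ] H}
    (hT : Tendsto (sNumbers T) atTop (𝓝 0)) :
    (∃ A B : H →L[ℂ] H, T = A * diagOp b (sNumbers T) * B) ∧
      ∃ A B : H →L[ℂ] H, diagOp b (sNumbers T) = A * T * B := by
  obtain ⟨t, v, hanti, h0, hvo, hv1, hv0, hTo, hTn, hres⟩ :=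
    (isCompactOperator_of_sNumbers_tendsto hT).exists_svd
  have htb := hanti.abs_le_zero h0
  obtain ⟨V, hVn, hV⟩ := b.exists_clm_of_orthogonal (w := v) zero_le_one (fun i => by
    by_cases h : t i = 0
    · simp [hv0 i h]
    · exact (hv1 i h).le) hvo
  -- Where `t i = 0` the inverse is 0 by convention, so `U` kills `b i`, matching `v i = 0`.
  obtain ⟨U, hUn, hU⟩ := b.exists_clm_of_orthogonal (w := fun i => ((t i)⁻¹ : ℂ) • T (v i))
    zero_le_one (fun i => by
      rw [norm_smul, hTn, norm_inv, Complex.norm_real, Real.norm_of_nonneg (h0 i)]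
      exact inv_mul_le_one) fun i j hij => by
      rw [inner_smul_left, inner_smul_right, hTo i j hij, mul_zero, mul_zero]
  have hTV : T * V = U * diagOp b t := by
    refine b.ext_clm fun i => ?_
    simp only [mul_apply_eq_comp, hV, diagOp_apply b htb, map_smul, hU, smul_smul]
    by_cases h : t i = 0
    · simp [h, hv0 i h]
    · rw [mul_inv_cancel₀ (by exact_mod_cast h), one_smul]
  have hUT : diagOp b t = adjoint U * T * V := by
    refine b.ext_clm fun i => b.ext_inner fun j => ?_
    simp only [mul_apply_eq_comp, hV, diagOp_apply b htb, adjoint_inner_right, hU, inner_smul_left,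
      inner_smul_right, b.inner_eq_ite]
    by_cases hji : j = i
    · subst hji
      by_cases h : t j = 0
      · simp [h]
      · rw [inner_self_eq_norm_sq_to_K, hTn]
        have : (t j : ℂ) ≠ 0 := by exact_mod_cast h
        simp only [map_inv₀, Complex.conj_ofReal, if_true, mul_one]
        rw [eq_inv_mul_iff_mul_eq₀ this, sq]
        rfl
    · simp [hji, hTo j i hji]
  -- `V` is a partial isometry, so `1 - V V*` projects onto the complement of all `v i`. There `T`
  -- vanishes because `t` tends to 0, which gives `T = U diag(t) V*`.
  have hVV : V * adjoint V * V = V := by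
    refine b.ext_clm fun i => ?_
    have : adjoint V (v i) = if t i = 0 then 0 else b i := by
      refine b.ext_inner fun j => ?_
      rw [adjoint_inner_right, hV]
      by_cases h : t i = 0
      · simp [h, hv0 i h]
      · by_cases hji : j = i
        · subst hji
          rw [inner_self_eq_norm_sq_to_K, hv1 j h]
          simp [h, b.orthonormal.1]
        · simp [hvo j i hji, h, b.inner_eq_ite, hji]
    simp only [mul_apply_eq_comp, hV, this]
    by_cases h : t i = 0
    · simp [h, hv0 i h]
    · simp [h, hV]
  have hVV' : adjoint V * V * adjoint V = adjoint V := by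
    have := congrArg star hVV
    rw [star_mul, star_mul, star_eq_adjoint, star_eq_adjoint, adjoint_adjoint] at this
    rwa [mul_assoc]
  have hadj : ∀ S : H →L[ℂ] H, ‖S‖ ≤ 1 → ‖adjoint S‖ ≤ 1 := fun S hS => by
    rwa [LinearIsometryEquiv.norm_map]
  have hcontr : ∀ (A X B : H →L[ℂ] H), ‖A‖ ≤ 1 → ‖B‖ ≤ 1 → ∀ n,
      sNumbers (A * X * B) n ≤ sNumbers X n := fun A X B hA hB n =>
    (sNumbers_mul_mul_le A X B n).trans (mul_le_of_le_one_left (sNumbers_nonneg X n)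
      (mul_le_one₀ hA (norm_nonneg _) hB))
  have hle : ∀ n, t n ≤ sNumbers T n := fun n => by
    have h := hcontr (adjoint U) T V (hadj U hUn) hVn n
    rwa [← hUT, sNumbers_diagOp b hanti h0] at h
  have ht : Tendsto t atTop (𝓝 0) := squeeze_zero h0 hle hT
  have hTVV : T = U * diagOp b t * adjoint V := by
    rw [← hTV]
    ext x
    have hy : ∀ i, inner ℂ (v i) (x - V (adjoint V x)) = 0 := fun i => by
      rw [← hV, ← adjoint_inner_right, map_sub]
      have := congrArg (fun S : H →L[ℂ] H => S x) hVV'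
      simp only [mul_apply_eq_comp] at this
      rw [this, sub_self, inner_zero_right]
    have hle0 : ‖T (x - V (adjoint V x))‖ ≤ 0 * ‖x - V (adjoint V x)‖ :=
      ge_of_tendsto' (ht.mul_const _) (hres _ hy)
    rw [zero_mul, norm_le_zero_iff, map_sub, sub_eq_zero] at hle0
    exact hle0
  have hdiag : sNumbers T = t := by
    funext n
    refine le_antisymm ?_ (hle n)
    have h := hcontr U (diagOp b t) (adjoint V) hUn (hadj V hVn) n
    rwa [← hTVV, sNumbers_diagOp b hanti h0] at h
  rw [hdiag]
  exact ⟨⟨U, adjoint V, hTVV⟩, ⟨adjoint U, V, hUT⟩⟩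

end SingularValues

/-! ### Calkin's correspondence between ideals and sequences. -/

section Calkin

variable {H : Type*} [NormedAddCommGroup H] [InnerProductSpace ℂ H]

lemma exists_hilbertBasis_nat [CompleteSpace H] [TopologicalSpace.SeparableSpace H]
    (hH : ¬ FiniteDimensional ℂ H) : Nonempty (HilbertBasis ℕ ℂ H) := by
  obtain ⟨w, b, hb⟩ := exists_hilbertBasis ℂ H
  have ho : Orthonormal ℂ ((↑) : w → H) := hb ▸ b.orthonormal
  have hc : w.Countable := by
    -- Distinct orthonormal vectors are at distance √2, so the balls of radius 1/2 are disjoint.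
    refine Set.PairwiseDisjoint.countable_of_isOpen (s := fun x : H => Metric.ball x (1 / 2)) ?_
      (fun _ _ => Metric.isOpen_ball) fun x _ => ⟨x, Metric.mem_ball_self (by norm_num)⟩
    intro x hx y hy hxy
    refine Metric.ball_disjoint_ball ?_
    have h0 : inner ℂ x y = 0 := ho.2 (i := ⟨x, hx⟩) (j := ⟨y, hy⟩) (by simpa using hxy)
    have h1 : ‖x - y‖ ^ 2 = 2 := by
      have hx1 : ‖x‖ = 1 := ho.1 ⟨x, hx⟩
      have hy1 : ‖y‖ = 1 := ho.1 ⟨y, hy⟩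
      rw [norm_sub_sq (𝕜 := ℂ), h0, hx1, hy1]
      norm_num
    rw [dist_eq_norm]
    nlinarith [norm_nonneg (x - y)]
  have hi : w.Infinite := by
    intro hf
    apply hH
    have hs : Submodule.span ℂ (Set.range b) = Submodule.span ℂ w := by rw [hb]; simp
    have hfin : FiniteDimensional ℂ (Submodule.span ℂ w) := FiniteDimensional.span_of_finite ℂ hf
    have h := b.dense_span
    rw [hs, IsClosed.submodule_topologicalClosure_eq
      (Submodule.closed_of_finiteDimensional _)] at h
    rw [h] at hfin
    exact Module.Finite.equiv Submodule.topEquiv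
  have : Countable w := hc
  have : Infinite w := hi.to_subtype
  obtain ⟨e⟩ := nonempty_equiv_of_countable (α := ℕ) (β := w)
  refine ⟨HilbertBasis.mk (b.orthonormal.comp e e.injective) ?_⟩
  rw [Set.range_comp, e.range_eq_univ, Set.image_univ, b.dense_span]

variable [CompleteSpace H]

/-- An operator whose `s`-numbers are bounded below is bounded below on the span of an orthonormal
sequence that it maps to an orthogonal one. -/
lemma exists_orthonormal_of_le_sNumbers {T : H →L[ℂ] H} {c : ℝ} (hc : 0 < c)
    (hT : ∀ n, c ≤ sNumbers T n) :
    ∃ v : ℕ → H, (∀ n, ‖v n‖ = 1 ∧ c / 2 ≤ ‖T (v n)‖) ∧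
      ∀ i j, i ≠ j → inner ℂ (v i) (v j) = 0 ∧ inner ℂ (T (v i)) (T (v j)) = 0 := by
  classical
  obtain ⟨v, hv, hr⟩ := exists_seq_of_forall_finset_exists
    (fun x : H => ‖x‖ = 1 ∧ c / 2 ≤ ‖T x‖)
    (fun x y => inner ℂ x y = 0 ∧ inner ℂ (T x) (T y) = 0) (fun s _ => by
      -- Orthogonality to the earlier `x` and to `T* T x` makes both the vectors and their images
      -- orthogonal. As `T P_W` has finite rank, `T` is still large off `W`.
      let s' : Finset H := s ∪ s.image fun x => ContinuousLinearMap.adjoint T (T x)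
      let W : Submodule ℂ H := Submodule.span ℂ (s' : Set H)
      have hW : FiniteDimensional ℂ W := FiniteDimensional.span_finset ℂ s'
      have hrank : ((T * W.starProjection : H →L[ℂ] H) : H →ₗ[ℂ] H).rank ≤ (s'.card : Cardinal) := by
        refine (LinearMap.rank_comp_le_right (W.starProjection : H →ₗ[ℂ] H)
          (T : H →ₗ[ℂ] H)).trans ?_
        have : LinearMap.range (W.starProjection : H →ₗ[ℂ] H) ≤ W := by
          rintro _ ⟨x, rfl⟩
          exact W.starProjection_apply_mem x
        exact (Submodule.rank_mono this).trans (rank_span_finset_le s')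
      have hn : c / 2 < ‖T - T * W.starProjection‖ :=
        (half_lt_self hc).trans_le ((hT _).trans (sNumbers_le hrank))
      obtain ⟨x, hx⟩ : ∃ x, c / 2 * ‖x‖ < ‖(T - T * W.starProjection) x‖ := by
        by_contra! h
        exact absurd (ContinuousLinearMap.opNorm_le_bound _ (half_pos hc).le h) (not_le.2 hn)
      let y := x - W.starProjection x
      have hTy : (T - T * W.starProjection) x = T y := by simp [y]
      have hyW : y ∈ Wᗮ := W.sub_starProjection_mem_orthogonal x
      have hyx : ‖y‖ ≤ ‖x‖ := by
        have h1 := Wᗮ.norm_starProjection_apply_le x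
        rwa [Submodule.starProjection_orthogonal_val] at h1
      have hy : c / 2 * ‖y‖ < ‖T y‖ := by
        rw [← hTy]
        exact (mul_le_mul_of_nonneg_left hyx (half_pos hc).le).trans_lt hx
      have hy0 : y ≠ 0 := by
        rintro h
        simp [h] at hy
      have hyn : 0 < ‖y‖ := norm_pos_iff.2 hy0
      have horth : ∀ x ∈ s', inner ℂ x y = 0 := fun x hx =>
        (Submodule.mem_orthogonal W y).1 hyW x (Submodule.subset_span hx)
      refine ⟨((‖y‖⁻¹ : ℝ) : ℂ) • y, ⟨?_, ?_⟩, fun z hz => ⟨?_, ?_⟩⟩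
      · rw [norm_smul, Complex.norm_real, norm_inv, norm_norm, inv_mul_cancel₀ hyn.ne']
      · rw [map_smul, norm_smul, Complex.norm_real, norm_inv, norm_norm, inv_mul_eq_div,
          le_div_iff₀ hyn]
        exact hy.le
      · rw [inner_smul_right, horth z (Finset.mem_union_left _ hz), mul_zero]
      · rw [map_smul, inner_smul_right, ← ContinuousLinearMap.adjoint_inner_left,
          horth _ (Finset.mem_union_right _ (Finset.mem_image_of_mem _ hz)), mul_zero])
  refine ⟨v, hv, fun i j hij => ?_⟩
  rcases lt_or_gt_of_ne hij with h | h
  · exact hr i j h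
  · obtain ⟨h1, h2⟩ := hr j i h
    rw [← inner_conj_symm, h1, ← inner_conj_symm, h2]
    simp

open ContinuousLinearMap in
/-- Calkin: the `s`-numbers of an operator in a proper ideal tend to zero. -/
lemma sNumbers_tendsto_of_mem (b : HilbertBasis ℕ ℂ H) {I : TwoSidedIdeal (H →L[ℂ] H)}
    (hI : I ≠ ⊤) {T : H →L[ℂ] H} (hT : T ∈ I) : Tendsto (sNumbers T) atTop (𝓝 0) := by
  have hbdd : BddBelow (Set.range (sNumbers T)) :=
    ⟨0, by rintro _ ⟨n, rfl⟩; exact sNumbers_nonneg T n⟩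
  have hlim := tendsto_atTop_ciInf (sNumbers_antitone T) hbdd
  rcases (le_ciInf (sNumbers_nonneg T)).eq_or_lt with h | hc
  · rwa [← h] at hlim
  · exfalso
    obtain ⟨v, hv, ho⟩ := exists_orthonormal_of_le_sNumbers hc fun n => ciInf_le hbdd n
    set c := ⨅ n, sNumbers T n
    obtain ⟨V, -, hV⟩ := b.exists_clm_of_orthogonal (w := v) zero_le_one (fun i => (hv i).1.le)
      fun i j hij => (ho i j hij).1
    obtain ⟨U, -, hU⟩ := b.exists_clm_of_orthogonal (w := fun i => T (v i)) (C := ‖T‖)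
      (norm_nonneg _) (fun i => by simpa [(hv i).1] using T.le_opNorm (v i))
      fun i j hij => (ho i j hij).2
    have hpos : ∀ i, 0 < ‖T (v i)‖ := fun i => (half_pos hc).trans_le (hv i).2
    have hξ : ∀ i, |(‖T (v i)‖ ^ 2)⁻¹| ≤ ((c / 2) ^ 2)⁻¹ := fun i => by
      rw [abs_of_nonneg (by positivity)]
      have := (hv i).2
      gcongr
    -- With a positive limit `c`, `U* T V` is diagonal with entries bounded below, so it is
    -- invertible and the ideal contains 1.
    have h1 : diagOp b (fun i => (‖T (v i)‖ ^ 2)⁻¹) * adjoint U * T * V = 1 := by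
      have h2 : adjoint U * T * V = diagOp b fun i => ‖T (v i)‖ ^ 2 := by
        refine eq_diagOp b (C := ‖T‖ ^ 2) (fun i => ?_) fun i => b.ext_inner fun j => ?_
        · rw [abs_of_nonneg (by positivity)]
          gcongr
          simpa [(hv i).1] using T.le_opNorm (v i)
        · simp only [mul_apply_eq_comp, hV, adjoint_inner_right, hU, inner_smul_right,
            b.inner_eq_ite]
          by_cases hji : j = i
          · subst hji
            rw [inner_self_eq_norm_sq_to_K]
            simp
          · simp [hji, (ho j i hji).2]
      rw [mul_assoc, mul_assoc, ← mul_assoc (adjoint U), h2]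
      refine b.ext_clm fun i => ?_
      have h3 : ∀ i, |‖T (v i)‖ ^ 2| ≤ ‖T‖ ^ 2 := fun i => by
        rw [abs_of_nonneg (by positivity)]
        gcongr
        simpa [(hv i).1] using T.le_opNorm (v i)
      have h4 : ((‖T (v i)‖ : ℂ) ^ 2) ≠ 0 := by exact_mod_cast (pow_pos (hpos i) 2).ne'
      rw [mul_apply_eq_comp, diagOp_apply b h3, map_smul, diagOp_apply b hξ, smul_smul]
      push_cast
      rw [mul_inv_cancel₀ h4]
      simp
    apply hI
    rw [← TwoSidedIdeal.one_mem_iff, ← h1]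
    exact I.mul_mem_right _ _ (I.mul_mem_left _ _ hT)

/-- The characteristic set of an ideal, in terms of the diagonal operators in a fixed basis. -/
lemma mem_charSet_iff (b : HilbertBasis ℕ ℂ H) (I : TwoSidedIdeal (H →L[ℂ] H)) {ξ : ℕ → ℝ} :
    ξ ∈ charSet I ↔ ξ ∈ cZeroStar ∧ diagOp b ξ ∈ I := by
  refine and_congr_right fun hξ => ⟨?_, fun h => ?_⟩
  · rintro ⟨X, hX, rfl⟩
    obtain ⟨A, B, h⟩ := (exists_factorization_of_sNumbers_tendsto b hξ.2).2
    rw [h]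
    exact I.mul_mem_right _ _ (I.mul_mem_left _ _ hX)
  · exact ⟨_, h, sNumbers_diagOp b hξ.1 fun i => hξ.1.le_of_tendsto hξ.2 i⟩

lemma mem_ideal_iff (b : HilbertBasis ℕ ℂ H) {I : TwoSidedIdeal (H →L[ℂ] H)} {T : H →L[ℂ] H}
    (hT : Tendsto (sNumbers T) atTop (𝓝 0)) : T ∈ I ↔ diagOp b (sNumbers T) ∈ I := by
  obtain ⟨⟨A, B, h⟩, ⟨A', B', h'⟩⟩ := exists_factorization_of_sNumbers_tendsto b hT
  constructor
  · intro hT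
    rw [h']
    exact I.mul_mem_right _ _ (I.mul_mem_left _ _ hT)
  · intro hD
    rw [h]
    exact I.mul_mem_right _ _ (I.mul_mem_left _ _ hD)

end Calkin

/-! ### Characteristic sets: closure properties, countable generation, sums. -/

section CharacteristicSets

lemma nonneg_of_mem_cZeroStar {ξ : ℕ → ℝ} (hξ : ξ ∈ cZeroStar) (i : ℕ) : 0 ≤ ξ i :=
  hξ.1.le_of_tendsto hξ.2 i

lemma abs_le_of_mem_cZeroStar {ξ : ℕ → ℝ} (hξ : ξ ∈ cZeroStar) (i : ℕ) : |ξ i| ≤ ξ 0 :=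
  hξ.1.abs_le_zero (nonneg_of_mem_cZeroStar hξ) i

lemma add_mem_cZeroStar {ξ η : ℕ → ℝ} (hξ : ξ ∈ cZeroStar) (hη : η ∈ cZeroStar) :
    ξ + η ∈ cZeroStar :=
  ⟨hξ.1.add hη.1, add_zero (0 : ℝ) ▸ hξ.2.add hη.2⟩

lemma mul_mem_cZeroStar {ξ η : ℕ → ℝ} (hξ : ξ ∈ cZeroStar) (hη : η ∈ cZeroStar) :
    ξ * η ∈ cZeroStar :=
  ⟨fun _ _ hij => mul_le_mul (hξ.1 hij) (hη.1 hij) (nonneg_of_mem_cZeroStar hη _)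
    (nonneg_of_mem_cZeroStar hξ _), mul_zero (0 : ℝ) ▸ hξ.2.mul hη.2⟩

lemma smul_mem_cZeroStar {ξ : ℕ → ℝ} (hξ : ξ ∈ cZeroStar) {c : ℝ} (hc : 0 ≤ c) :
    c • ξ ∈ cZeroStar :=
  ⟨fun _ _ hij => mul_le_mul_of_nonneg_left (hξ.1 hij) hc, mul_zero c ▸ hξ.2.const_mul c⟩

/-- The `2`-fold ampliation `⟨ξ 0, ξ 0, ξ 1, ξ 1, …⟩` of a sequence. -/
def ampliation (ξ : ℕ → ℝ) (n : ℕ) : ℝ := ξ (n / 2)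

lemma ampliation_mem_cZeroStar {ξ : ℕ → ℝ} (hξ : ξ ∈ cZeroStar) : ampliation ξ ∈ cZeroStar :=
  ⟨fun _ _ hij => hξ.1 (Nat.div_le_div_right hij),
    hξ.2.comp (Nat.tendsto_div_const_atTop two_ne_zero)⟩

lemma le_ampliation {ξ : ℕ → ℝ} (hξ : Antitone ξ) (n : ℕ) : ξ n ≤ ampliation ξ n :=
  hξ (Nat.div_le_self n 2)

variable {H : Type*} [NormedAddCommGroup H] [InnerProductSpace ℂ H]

lemma sNumbers_add_le_ampliation (X Y : H →L[ℂ] H) (n : ℕ) :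
    sNumbers (X + Y) n ≤ ampliation (sNumbers X) n + ampliation (sNumbers Y) n :=
  (sNumbers_antitone _ (by omega : n / 2 + n / 2 ≤ n)).trans (sNumbers_add_le X Y _ _)

variable [CompleteSpace H]

lemma sNumbers_mem_charSet (b : HilbertBasis ℕ ℂ H) {I : TwoSidedIdeal (H →L[ℂ] H)} (hI : I ≠ ⊤)
    {X : H →L[ℂ] H} (hX : X ∈ I) : sNumbers X ∈ charSet I :=
  ⟨⟨sNumbers_antitone X, sNumbers_tendsto_of_mem b hI hX⟩, X, hX, rfl⟩

variable {I : TwoSidedIdeal (H →L[ℂ] H)}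

lemma zero_mem_charSet (b : HilbertBasis ℕ ℂ H) : (0 : ℕ → ℝ) ∈ charSet I := by
  refine (mem_charSet_iff b I).2 ⟨⟨fun _ _ _ => le_rfl, tendsto_const_nhds⟩, ?_⟩
  rw [← eq_diagOp b (ξ := 0) (C := 0) (by simp) (T := 0) (by simp)]
  exact I.zero_mem

/-- The quotient `ξ / η` is bounded by 1, and where `η` vanishes so does `ξ`; hence `diag ξ = diag
(ξ / η) diag η`. -/
lemma mem_charSet_of_le (b : HilbertBasis ℕ ℂ H) {ξ η : ℕ → ℝ} (hξ : ξ ∈ cZeroStar)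
    (hη : η ∈ charSet I) (h : ∀ i, ξ i ≤ η i) : ξ ∈ charSet I := by
  rw [mem_charSet_iff b] at hη ⊢
  refine ⟨hξ, ?_⟩
  have h1 : ∀ i, |(ξ / η) i| ≤ 1 := fun i => by
    have h0 := nonneg_of_mem_cZeroStar hξ i
    rw [Pi.div_apply, abs_of_nonneg (div_nonneg h0 (h0.trans (h i)))]
    exact div_le_one_of_le₀ (h i) (h0.trans (h i))
  have h2 : ξ / η * η = ξ := by
    funext i
    by_cases hi : η i = 0
    · have := h i
      rw [hi] at this
      simp [hi, le_antisymm this (nonneg_of_mem_cZeroStar hξ i)]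
    · simp [hi]
  rw [← h2, ← diagOp_mul b h1 (abs_le_of_mem_cZeroStar hη.1)]
  exact I.mul_mem_left _ _ hη.2

lemma add_mem_charSet (b : HilbertBasis ℕ ℂ H) {ξ η : ℕ → ℝ} (hξ : ξ ∈ charSet I)
    (hη : η ∈ charSet I) : ξ + η ∈ charSet I := by
  rw [mem_charSet_iff b] at hξ hη ⊢
  refine ⟨add_mem_cZeroStar hξ.1 hη.1, ?_⟩
  rw [← diagOp_add b (abs_le_of_mem_cZeroStar hξ.1) (abs_le_of_mem_cZeroStar hη.1)]
  exact I.add_mem hξ.2 hη.2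

lemma smul_mem_charSet (b : HilbertBasis ℕ ℂ H) {ξ : ℕ → ℝ} (hξ : ξ ∈ charSet I) {c : ℝ}
    (hc : 0 ≤ c) : c • ξ ∈ charSet I := by
  rw [mem_charSet_iff b] at hξ ⊢
  refine ⟨smul_mem_cZeroStar hξ.1 hc, ?_⟩
  have h : c • ξ = (fun _ => c) * ξ := rfl
  rw [h, ← diagOp_mul b (C := |c|) (fun _ => le_rfl) (abs_le_of_mem_cZeroStar hξ.1)]
  exact I.mul_mem_left _ _ hξ.2

open ContinuousLinearMap in
-- Two copies of `diag ξ` are moved by isometries onto the even and the odd basis vectors and added.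
lemma ampliation_mem_charSet (b : HilbertBasis ℕ ℂ H) {ξ : ℕ → ℝ} (hξ : ξ ∈ charSet I) :
    ampliation ξ ∈ charSet I := by
  rw [mem_charSet_iff b] at hξ ⊢
  refine ⟨ampliation_mem_cZeroStar hξ.1, ?_⟩
  have hV : ∀ j : ℕ, ∃ V : H →L[ℂ] H, ∀ i, V (b i) = b (2 * i + j) := fun j => by
    obtain ⟨V, -, hV⟩ := b.exists_clm_of_orthogonal (w := fun i => b (2 * i + j)) zero_le_one
      (fun i => (b.orthonormal.1 _).le) fun i k hik => b.orthonormal.2 (by omega)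
    exact ⟨V, hV⟩
  choose V hV using hV
  have hVadj : ∀ j i, adjoint (V j) (b (2 * i + j)) = b i := fun j i => b.ext_inner fun k => by
    rw [adjoint_inner_right, hV, b.inner_eq_ite, b.inner_eq_ite]
    simp
  have hVadj0 : ∀ j i, (∀ k, i ≠ 2 * k + j) → adjoint (V j) (b i) = 0 := fun j i hi =>
    b.ext_inner fun k => by
      rw [adjoint_inner_right, hV, b.inner_eq_ite, if_neg (hi k).symm, inner_zero_right]
  have hsum : V 0 * diagOp b ξ * adjoint (V 0) + V 1 * diagOp b ξ * adjoint (V 1) =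
      diagOp b (ampliation ξ) := by
    refine eq_diagOp b (abs_le_of_mem_cZeroStar (ampliation_mem_cZeroStar hξ.1)) fun i => ?_
    have hd := diagOp_apply b (abs_le_of_mem_cZeroStar hξ.1)
    rw [add_apply, mul_apply_eq_comp, mul_apply_eq_comp, mul_apply_eq_comp, mul_apply_eq_comp]
    obtain ⟨k, rfl | rfl⟩ : ∃ k, i = 2 * k + 0 ∨ i = 2 * k + 1 := ⟨i / 2, by omega⟩
    · rw [hVadj, hVadj0 1 _ fun l => by omega, hd, map_smul, hV]
      simp [ampliation]
    · rw [hVadj, hVadj0 0 _ fun l => by omega, hd, map_smul, hV]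
      simp [ampliation, Nat.mul_add_div]
  rw [← hsum]
  exact I.add_mem (I.mul_mem_right _ _ (I.mul_mem_left _ _ hξ.2))
    (I.mul_mem_right _ _ (I.mul_mem_left _ _ hξ.2))

/-- A sequence of members of the characteristic set that exhausts a countably generated ideal. -/
lemma exists_exhausting_sequence (b : HilbertBasis ℕ ℂ H) {J : TwoSidedIdeal (H →L[ℂ] H)}
    (hJ : J ≠ ⊤) (hJcg : IsCountablyGeneratedIdeal J) :
    ∃ ρ : ℕ → ℕ → ℝ, (∀ k, ρ k ∈ charSet J) ∧
      ∀ T ∈ J, ∃ k, ∀ n, ampliation (sNumbers T) n ≤ ρ k n := by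
  obtain ⟨S, hS, hJS⟩ := hJcg
  -- Adding 0 makes the generating set nonempty, so that ℕ enumerates it.
  obtain ⟨X, hX⟩ := (hS.insert 0).exists_eq_range ⟨0, Set.mem_insert _ _⟩
  have hXJ : ∀ k, X k ∈ J := fun k => by
    have : X k ∈ insert 0 S := hX ▸ Set.mem_range_self k
    rcases this with h | h
    · rw [h]; exact J.zero_mem
    · rw [hJS]; exact TwoSidedIdeal.subset_span h
  -- Each step absorbs one more generator. The doubling and the ampliation make the operators with
  -- s-numbers below some `ρ k` closed under scaling and addition, hence an ideal `P` containing
  -- `J`.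
  let ρ : ℕ → ℕ → ℝ := fun k => Nat.rec 0 (fun k r => ampliation (r + r + sNumbers (X k))) k
  have hρs : ∀ k, ρ (k + 1) = ampliation (ρ k + ρ k + sNumbers (X k)) := fun _ => rfl
  have hρ : ∀ k, ρ k ∈ charSet J := fun k => by
    induction k with
    | zero => exact zero_mem_charSet b
    | succ k ih =>
      rw [hρs]
      exact ampliation_mem_charSet b
        (add_mem_charSet b (add_mem_charSet b ih ih) (sNumbers_mem_charSet b hJ (hXJ k)))
  have h0 : ∀ k n, 0 ≤ ρ k n := fun k => nonneg_of_mem_cZeroStar (hρ k).1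
  have hamp : ∀ k n, 2 * ampliation (ρ k) n ≤ ρ (k + 1) n := fun k n => by
    have := sNumbers_nonneg (X k) (n / 2)
    rw [hρs]
    simp only [ampliation, Pi.add_apply]
    linarith
  have htwo : ∀ k n, 2 * ρ k n ≤ ρ (k + 1) n := fun k n =>
    (mul_le_mul_of_nonneg_left (le_ampliation (hρ k).1.1 n) zero_le_two).trans (hamp k n)
  have hmono : ∀ n, Monotone fun k => ρ k n := fun n =>
    monotone_nat_of_le_succ fun k => by linarith [htwo k n, h0 k n]
  have hpow : ∀ m k n, 2 ^ m * ρ k n ≤ ρ (k + m) n := fun m k n => by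
    induction m with
    | zero => simp
    | succ m ih =>
      rw [← add_assoc, pow_succ]
      linarith [htwo (k + m) n]
  have hscale : ∀ {T T' : H →L[ℂ] H} (C : ℝ), (∀ n, sNumbers T' n ≤ C * sNumbers T n) →
      (∃ k, ∀ n, sNumbers T n ≤ ρ k n) → ∃ k, ∀ n, sNumbers T' n ≤ ρ k n := by
    rintro T T' C hC ⟨k, hk⟩
    obtain ⟨m, hm⟩ := pow_unbounded_of_one_lt C one_lt_two
    refine ⟨k + m, fun n => ?_⟩
    calc _ ≤ C * sNumbers T n := hC n
      _ ≤ 2 ^ m * sNumbers T n := mul_le_mul_of_nonneg_right hm.le (sNumbers_nonneg _ _)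
      _ ≤ 2 ^ m * ρ k n := mul_le_mul_of_nonneg_left (hk n) (by positivity)
      _ ≤ _ := hpow m k n
  have h1 : ‖(1 : H →L[ℂ] H)‖ ≤ 1 := ContinuousLinearMap.norm_id_le
  let P : TwoSidedIdeal (H →L[ℂ] H) := TwoSidedIdeal.mk' {T | ∃ k, ∀ n, sNumbers T n ≤ ρ k n}
    ⟨0, fun n => by
      have : sNumbers (0 : H →L[ℂ] H) n ≤ 0 := by
        simpa using sNumbers_le (X := (0 : H →L[ℂ] H)) (F := 0) (n := n) (by simp)
      exact this.trans (h0 0 n)⟩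
    (by
      rintro A B ⟨k, hk⟩ ⟨l, hl⟩
      refine ⟨max k l + 1, fun n => (sNumbers_add_le_ampliation A B n).trans ?_⟩
      refine le_trans ?_ (hamp _ n)
      have h2 := (hk (n / 2)).trans (hmono _ (le_max_left k l))
      have h3 := (hl (n / 2)).trans (hmono _ (le_max_right k l))
      simp only [ampliation]
      linarith)
    (fun {A} => hscale (‖(-1 : H →L[ℂ] H)‖ * ‖(1 : H →L[ℂ] H)‖) fun n => by
      simpa using sNumbers_mul_mul_le (-1) A 1 n)
    (fun {A B} => hscale (‖A‖ * ‖(1 : H →L[ℂ] H)‖) fun n => by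
      simpa using sNumbers_mul_mul_le A B 1 n)
    (fun {A B} => hscale (‖(1 : H →L[ℂ] H)‖ * ‖B‖) fun n => by
      simpa using sNumbers_mul_mul_le 1 A B n)
  have hP : J ≤ P := by
    rw [hJS, TwoSidedIdeal.span_le]
    intro T hT
    obtain ⟨k, rfl⟩ : T ∈ Set.range X := hX ▸ Set.mem_insert_of_mem _ hT
    refine (TwoSidedIdeal.mem_mk' ..).2 ⟨k + 1, fun n => ?_⟩
    rw [hρs]
    refine (le_ampliation (sNumbers_antitone _) n).trans ?_
    simp only [ampliation, Pi.add_apply]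
    linarith [h0 k (n / 2)]
  refine ⟨ρ, hρ, fun T hT => ?_⟩
  obtain ⟨k, hk⟩ := (TwoSidedIdeal.mem_mk' ..).1 (hP hT)
  refine ⟨k + 1, fun n => le_trans ?_ (hamp k n)⟩
  have := hk (n / 2)
  have := h0 k (n / 2)
  simp only [ampliation]
  linarith

/-- All s-numbers of 1 equal 1, so 1 is not a sum of two operators whose s-numbers tend to 0. -/
lemma sup_ne_top (b : HilbertBasis ℕ ℂ H) {I J : TwoSidedIdeal (H →L[ℂ] H)} (hI : I ≠ ⊤)
    (hJ : J ≠ ⊤) : I ⊔ J ≠ ⊤ := by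
  intro h
  have h1 : (1 : H →L[ℂ] H) ∈ I ⊔ J := h ▸ TwoSidedIdeal.mem_top _
  obtain ⟨X, hX, Y, hY, hXY⟩ := TwoSidedIdeal.mem_sup.1 h1
  have hlim := (sNumbers_tendsto_of_mem b hI hX).add (sNumbers_tendsto_of_mem b hJ hY)
  have hone : (1 : H →L[ℂ] H) = diagOp b fun _ => 1 :=
    eq_diagOp b (C := 1) (by simp) (by simp)
  have hs : ∀ n, 1 ≤ sNumbers X n + sNumbers Y n := fun n => by
    have := sNumbers_add_le X Y n n
    rwa [hXY, hone, sNumbers_diagOp b (fun _ _ _ => le_rfl) fun _ => zero_le_one] at this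
  have := ge_of_tendsto' hlim hs
  norm_num at this

/-- The s-numbers of `X + Y` lie below the sum of the two ampliations: that of `X` stays in Σ(I),
that of `Y` is absorbed by some `ρ k`. The converse is heredity of Σ(I + J). -/
lemma mem_charSet_sup_iff (b : HilbertBasis ℕ ℂ H) {I J : TwoSidedIdeal (H →L[ℂ] H)} (hI : I ≠ ⊤)
    {ρ : ℕ → ℕ → ℝ} (hρ : ∀ k, ρ k ∈ charSet J)
    (hJρ : ∀ T ∈ J, ∃ k, ∀ n, ampliation (sNumbers T) n ≤ ρ k n) {ξ : ℕ → ℝ} (hξ : ξ ∈ cZeroStar) :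
    ξ ∈ charSet (I ⊔ J) ↔ ∃ k, ∃ ζ ∈ charSet I, ∀ n, ξ n ≤ ζ n + ρ k n := by
  constructor
  · rintro ⟨-, T, hT, rfl⟩
    obtain ⟨X, hX, Y, hY, rfl⟩ := TwoSidedIdeal.mem_sup.1 hT
    obtain ⟨k, hk⟩ := hJρ Y hY
    exact ⟨k, _, ampliation_mem_charSet b (sNumbers_mem_charSet b hI hX), fun n =>
      (sNumbers_add_le_ampliation X Y n).trans (add_le_add_right (hk n) _)⟩
  · rintro ⟨k, ζ, hζ, h⟩
    have h1 : ζ ∈ charSet (I ⊔ J) :=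
      ⟨hζ.1, hζ.2.imp fun X hX => ⟨TwoSidedIdeal.mem_sup_left hX.1, hX.2⟩⟩
    have h2 : ρ k ∈ charSet (I ⊔ J) :=
      ⟨(hρ k).1, (hρ k).2.imp fun X hX => ⟨TwoSidedIdeal.mem_sup_right hX.1, hX.2⟩⟩
    exact mem_charSet_of_le b hξ (add_mem_charSet b h1 h2) h

end CharacteristicSets

/-! ### Soft complements and the main argument. -/

section SoftComplements

/-- A nonnegative null sequence attains its maximum on every tail. Thus `a ∘ j` is its least
nonincreasing majorant, with `j i` a place where the value is attained. -/
lemma exists_max_on_tails {a : ℕ → ℝ} (h0 : ∀ i, 0 ≤ a i) (ha : Tendsto a atTop (𝓝 0)) :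
    ∃ j : ℕ → ℕ, ∀ i, i ≤ j i ∧ ∀ l, i ≤ l → a l ≤ a (j i) := by
  suffices h : ∀ i, ∃ j, i ≤ j ∧ ∀ l, i ≤ l → a l ≤ a j by
    choose j hj using h
    exact ⟨j, hj⟩
  intro i
  by_cases h : ∃ l, i ≤ l ∧ 0 < a l
  · obtain ⟨l, hil, hl⟩ := h
    obtain ⟨N, hN⟩ := eventually_atTop.1 (ha.eventually_lt_const hl)
    obtain ⟨j, hj, hmax⟩ := Finset.exists_max_image (Finset.Icc i (max l N)) a
      ⟨i, Finset.mem_Icc.2 ⟨le_rfl, hil.trans (le_max_left _ _)⟩⟩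
    refine ⟨j, (Finset.mem_Icc.1 hj).1, fun m hm => ?_⟩
    by_cases hmN : m ≤ max l N
    · exact hmax m (Finset.mem_Icc.2 ⟨hm, hmN⟩)
    · exact (hN m (by omega)).le.trans
        (hmax l (Finset.mem_Icc.2 ⟨hil, le_max_left _ _⟩))
  · push Not at h
    exact ⟨i, le_rfl, fun l hl => (h l hl).trans (h0 i)⟩

lemma max_on_tails_mem_cZeroStar {a : ℕ → ℝ} (ha : Tendsto a atTop (𝓝 0))
    {j : ℕ → ℕ} (hj : ∀ i, i ≤ j i ∧ ∀ l, i ≤ l → a l ≤ a (j i)) : a ∘ j ∈ cZeroStar :=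
  ⟨fun _ k hik => (hj _).2 _ (hik.trans (hj k).1),
    ha.comp (tendsto_atTop_mono (fun i => (hj i).1) tendsto_id)⟩

/-- For every choice of indices `n k` there is a sequence decreasing to zero whose first `n k`
terms are at least `1 / (k + 1)`. -/
lemma exists_slowly_decreasing (n : ℕ → ℕ) :
    ∃ α ∈ cZeroStar, ∀ k, ∀ i < n k, ((k : ℝ) + 1)⁻¹ ≤ α i := by
  let M : ℕ → ℕ := fun k => ∑ j ∈ Finset.range (k + 1), (n j + 1)
  have hM : Monotone M := monotone_nat_of_le_succ fun k => by
    simp only [M]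
    rw [Finset.sum_range_succ _ (k + 1)]
    omega
  have hnM : ∀ k, n k ≤ M k := fun k => by
    simp only [M]
    rw [Finset.sum_range_succ]
    omega
  have hkM : ∀ k, k < M k := fun k => by
    have : ∑ j ∈ Finset.range (k + 1), 1 ≤ M k := Finset.sum_le_sum fun j _ => by omega
    simpa using this
  have hex : ∀ i, ∃ k, i < M k := fun i => ⟨i, hkM i⟩
  classical
  -- The witness is `1 / (κ i + 1)`, where `κ i` is the first `k` with `i < M k`.
  let κ : ℕ → ℕ := fun i => Nat.find (hex i)
  have hκ : Monotone κ := fun i j hij =>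
    Nat.find_mono fun k hk => hij.trans_lt hk
  have hκt : Tendsto κ atTop atTop := by
    refine tendsto_atTop_atTop.2 fun K => ⟨M K, fun i hi => ?_⟩
    refine (Nat.le_find_iff _ _).2 fun k hk hik => ?_
    exact absurd (hik.trans_le (hM hk.le)) (not_lt.2 hi)
  refine ⟨fun i => ((κ i : ℝ) + 1)⁻¹, ⟨fun i j hij => ?_, ?_⟩, fun k i hi => ?_⟩
  · have : (κ i : ℝ) ≤ κ j := by exact_mod_cast hκ hij
    exact inv_anti₀ (by positivity) (by linarith)
  · have := (tendsto_one_div_add_atTop_nhds_zero_nat (𝕜 := ℝ)).comp hκt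
    simpa [Function.comp_def] using this
  · have : (κ i : ℝ) ≤ k := by exact_mod_cast Nat.find_min' (hex i) (hi.trans_le (hnM k))
    exact inv_anti₀ (by positivity) (by linarith)

variable {H : Type*} [NormedAddCommGroup H] [InnerProductSpace ℂ H] [CompleteSpace H]

lemma IsStronglySoftComplemented.isSoftComplemented (b : HilbertBasis ℕ ℂ H)
    {K : TwoSidedIdeal (H →L[ℂ] H)} (hK : K ≠ ⊤) (h : IsStronglySoftComplemented K) :
    IsSoftComplemented K := by
  apply le_antisymm
  · refine TwoSidedIdeal.span_le.2 ?_
    rintro T ⟨ξ, ⟨hξ, hα⟩, b', hT⟩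
    rw [eq_diagOp b' (abs_le_of_mem_cZeroStar hξ) hT]
    suffices hmem : ξ ∈ charSet K from ((mem_charSet_iff b' K).1 hmem).2
    by_contra hmem
    -- A slowly decreasing `α` with `α ≥ 1 / (k + 1)` on the first `n k` terms then forces `α ξ` out
    -- of Σ(K).
    obtain ⟨n, hn⟩ := h (fun k => ((k : ℝ) + 1)⁻¹ • ξ) fun k => by
      refine ⟨smul_mem_cZeroStar hξ (by positivity), fun hk => hmem ?_⟩
      have hk' := smul_mem_charSet b hk (c := (k : ℝ) + 1) (by positivity)
      rwa [smul_smul, mul_inv_cancel₀ (by positivity), one_smul] at hk'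
    obtain ⟨α, hα0, hαn⟩ := exists_slowly_decreasing n
    exact hn (α * ξ) (mul_mem_cZeroStar hα0 hξ) (fun k i hi =>
      mul_le_mul_of_nonneg_right (hαn k i hi) (nonneg_of_mem_cZeroStar hξ i)) (hα α hα0)
  · intro T hT
    have hs := sNumbers_mem_charSet b hK hT
    refine (mem_ideal_iff b hs.1.2).2 (TwoSidedIdeal.subset_span ⟨sNumbers T, ⟨hs.1, ?_⟩, b,
      diagOp_apply b (abs_le_of_mem_cZeroStar hs.1)⟩)
    intro α hα
    exact mem_charSet_of_le b (mul_mem_cZeroStar hα hs.1)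
      (smul_mem_charSet b hs (nonneg_of_mem_cZeroStar hα 0)) fun i =>
      mul_le_mul_of_nonneg_right (hα.1 (Nat.zero_le i)) (sNumbers_nonneg T i)

lemma IsStronglySoftComplemented.sup_of_isCountablyGenerated (b : HilbertBasis ℕ ℂ H)
    {I J : TwoSidedIdeal (H →L[ℂ] H)} (hI : I ≠ ⊤) (hJ : J ≠ ⊤)
    (hIssc : IsStronglySoftComplemented I) (hJcg : IsCountablyGeneratedIdeal J) :
    IsStronglySoftComplemented (I ⊔ J) := by
  obtain ⟨ρ, hρ, hJρ⟩ := exists_exhausting_sequence b hJ hJcg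
  intro η hη
  let a : ℕ → ℕ → ℕ → ℝ := fun k m i => max (η m i - ρ k i) 0
  have ha0 : ∀ k m i, 0 ≤ a k m i := fun _ _ _ => le_max_right _ _
  have hat : ∀ k m, Tendsto (a k m) atTop (𝓝 0) := fun k m => by
    simpa using ((hη m).1.2.sub (hρ k).1.2).max (tendsto_const_nhds (x := (0 : ℝ)))
  choose j hj using fun k m => exists_max_on_tails (ha0 k m) (hat k m)
  have hL : ∀ k m, a k m ∘ j k m ∈ cZeroStar \ charSet I := fun k m => by
    refine ⟨max_on_tails_mem_cZeroStar (hat k m) (hj k m), fun hmem => (hη m).2 ?_⟩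
    refine (mem_charSet_sup_iff b hI hρ hJρ (hη m).1).2 ⟨k, _, hmem, fun i => ?_⟩
    have h1 := (hj k m i).2 i le_rfl
    have h2 : η m i - ρ k i ≤ a k m i := le_max_left _ _
    simp only [Function.comp_apply]
    linarith
  -- The shift by `k` confines `η m` to the indices `k ≤ m`, so the supremum below is finite and `m
  -- - k` is a true subtraction; the `+ 1` puts the place `j k m i` itself below the bound.
  choose N hN using fun k => hIssc (fun m => a k (k + m) ∘ j k (k + m)) fun m => hL k (k + m)
  refine ⟨fun m => (Finset.range (m + 1)).sup fun k =>
    (Finset.range (N k (m - k))).sup fun i => j k m i + 1, fun ξ hξ hdom hmem => ?_⟩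
  obtain ⟨k, ζ, hζ, hle⟩ := (mem_charSet_sup_iff b hI hρ hJρ hξ).1 hmem
  refine hN k ζ hζ.1 (fun m i hi => ?_) hζ
  have hlt : j k (k + m) i < (Finset.range (k + m + 1)).sup fun k' =>
      (Finset.range (N k' (k + m - k'))).sup fun i => j k' (k + m) i + 1 := by
    refine Nat.lt_of_succ_le (le_trans ?_ (Finset.le_sup (b := k) (Finset.mem_range.2 (by omega))))
    exact Finset.le_sup (f := fun i => j k (k + m) i + 1)
      (Finset.mem_range.2 (by rwa [Nat.add_sub_cancel_left]))
  have h1 := hdom (k + m) _ hlt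
  have h2 := hle (j k (k + m) i)
  -- At the place `j k (k + m) i ≥ i` the bound `η ≤ ξ ≤ ζ + ρ k` applies, and monotonicity of `ζ`
  -- carries it back to `i`.
  refine le_trans (max_le ?_ (nonneg_of_mem_cZeroStar hζ.1 _)) (hζ.1.1 (hj k (k + m) i).1)
  linarith

end SoftComplements

theorem theorem5p7 {H : Type*} [NormedAddCommGroup H] [InnerProductSpace ℂ H] [CompleteSpace H]
    [TopologicalSpace.SeparableSpace H] (hH : ¬ FiniteDimensional ℂ H)
    (I J : TwoSidedIdeal (H →L[ℂ] H)) (hI : I ≠ ⊤) (hJ : J ≠ ⊤)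
    (hIssc : IsStronglySoftComplemented I) (hJcg : IsCountablyGeneratedIdeal J) :
    IsStronglySoftComplemented (I ⊔ J) ∧ IsSoftComplemented (I ⊔ J) := by
  obtain ⟨b⟩ := exists_hilbertBasis_nat hH
  have h := hIssc.sup_of_isCountablyGenerated b hI hJ hJcg
  exact ⟨h, h.isSoftComplemented b (sup_ne_top b hI hJ)⟩
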